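/- Let $d\in\mathbb{N}$. For $1\le p\le\infty$ let $\mathcal{F}^p(\mathbb{C}^d)$ be the space of entire functions $F$ on $\mathbb{C}^d$ with $\|F\|_{\mathcal{F}^p} := \big\| F(z)\, e^{-\pi|z|^2/2} \big\|_{L^p(\mathbb{C}^d,\,dz)} < \infty$, where $dz$ is Lebesgue measure, $|z|^2=\sum_i|z_i|^2$ and $z\cdot w=\sum_i z_iw_i$. Let $\phi:\mathbb{C}^d\to\mathbb{C}$ be a (Lebesgue) measurable function, and let $S:\mathcal{F}^1(\mathbb{C}^d)\to\mathcal{F}^\infty(\mathbb{C}^d)$ be a linear operator of the form $$ SF(z)=\int_{\mathbb{C}^d} F(w)\,e^{\pi z\cdot\overline{w}}\,\phi(\overline{w}-z)\,e^{-\pi|w|^2}\,dw ,\qquad F\in\mathcal{F}^1(\mathbb{C}^d),\ z\in\mathbb{C}^d. $$ Suppose that there is $H\in L^1(\mathbb{C}^d)$ such that for all $z,w\in\mathbb{C}^d$ $$ |\phi(\overline{z}-w)| \le \big| e^{\pi(|z|^2+|w|^2)/2-\pi w\cdot\overline{z}} \big|\, H(z-w). $$ Then $S$ is bounded on $\mathcal{F}^p(\mathbb{C}^d)$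 for every $1\le p\le\infty$. That is, for every such $p$, every $F\in\mathcal{F}^p(\mathbb{C}^d)$ and every $z\in\mathbb{C}^d$ the integral above converges absolutely, and it defines a linear operator $\mathcal{F}^p(\mathbb{C}^d)\to\mathcal{F}^p(\mathbb{C}^d)$ which agrees with $S$ on $\mathcal{F}^1(\mathbb{C}^d)\cap\mathcal{F}^p(\mathbb{C}^d)$ and satisfies $\|SF\|_{\mathcal{F}^p}\le C\|F\|_{\mathcal{F}^p}$ for all $F\in\mathcal{F}^p(\mathbb{C}^d)$, with a constant $C<\infty$ that does not depend on $F$. -/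

import Mathlib

open MeasureTheory
open scoped ENNReal NNReal

noncomputable section

/-- The squared Euclidean length `|z|² = ∑ᵢ |zᵢ|²` of `z ∈ ℂ^d`. (The norm that Mathlib puts on
`Fin d → ℂ` is the sup norm, hence this definition.) -/
def absSq {d : ℕ} (z : Fin d → ℂ) : ℝ := ∑ i, ‖z i‖ ^ 2

/-- The function `F` multiplied by the square root of the Gaussian weight,
`z ↦ F(z) e^{-π|z|²/2}`. -/
def gaussWeighted {d : ℕ} (F : (Fin d → ℂ) → ℂ) (z : Fin d → ℂ) : ℂ :=
  F z * (Real.exp (-(Real.pi * absSq z / 2)) : ℂ)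

/-- The Fock space `𝓕^p(ℂ^d)`: the entire functions `F` on `ℂ^d` for which `F(z) e^{-π|z|²/2}`
lies in `L^p(ℂ^d)` with respect to Lebesgue measure. -/
def fockSpace (d : ℕ) (p : ℝ≥0∞) : Submodule ℂ ((Fin d → ℂ) → ℂ) where
  carrier := {F | Differentiable ℂ F ∧ MemLp (gaussWeighted F) p volume}
  zero_mem' := by
    refine ⟨differentiable_const 0, ?_⟩
    have h : gaussWeighted (0 : (Fin d → ℂ) → ℂ) = 0 := by
      funext z
      simp [gaussWeighted]
    rw [h]
    exact MemLp.zero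
  add_mem' := by
    rintro F G ⟨hF, hF'⟩ ⟨hG, hG'⟩
    refine ⟨hF.add hG, ?_⟩
    have h : gaussWeighted (F + G) = gaussWeighted F + gaussWeighted G := by
      funext z
      simp [gaussWeighted, add_mul]
    rw [h]
    exact hF'.add hG'
  smul_mem' := by
    rintro c F ⟨hF, hF'⟩
    refine ⟨hF.const_smul c, ?_⟩
    have h : gaussWeighted (c • F) = c • gaussWeighted F := by
      funext z
      simp [gaussWeighted, mul_assoc]
    rw [h]
    exact hF'.const_smul c

/-- The norm of `𝓕^p(ℂ^d)`: the `L^p` norm of `F(z) e^{-π|z|²/2}` (for `p = ∞` the essential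
supremum); it is finite on `fockSpace d p`. -/
def fockNorm {d : ℕ} (p : ℝ≥0∞) (F : (Fin d → ℂ) → ℂ) : ℝ≥0∞ :=
  eLpNorm (gaussWeighted F) p volume

/-- The integrand `F(w) e^{π z·w̄} φ(w̄ - z) e^{-π|w|²}`; here `star w` is the coordinatewise
complex conjugate of `w` and `z ⬝ᵥ star w = ∑ᵢ zᵢ w̄ᵢ`. -/
def fockIntegrand {d : ℕ} (φ F : (Fin d → ℂ) → ℂ) (z w : Fin d → ℂ) : ℂ :=
  F w * Complex.exp (Real.pi * (z ⬝ᵥ star w)) * φ (star w - z)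
    * (Real.exp (-(Real.pi * absSq w)) : ℂ)

end

/-! Since the modulus of the exponential in the hypothesis on `φ` is `e^{π|z-w|²/2}`, passing to
weighted functions turns the operator into something dominated by a convolution: `|SF| e^{-π|·|²/2}`
at `z` is at most `∫ |F(z+u)| e^{-π|z+u|²/2} H(u) du`. Young's inequality then gives the norm bound
with constant `‖H‖₁`.

The real issue is that `SF` is entire for `F ∈ 𝓕^p`. As `φ` is only measurable, this is known only
on `𝓕^1`, through `S`; and `𝓕^1` is not norm dense in `𝓕^∞`. Pointwise approximation suffices: the
sub-mean value property gives `𝓕^p ⊆ 𝓕^∞`, so the dilates `F(r·)`, `r < 1`, lie in `𝓕^1` with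
weighted sup norms bounded uniformly in `r`. As `r → 1`, dominated convergence with majorant `H`
gives `S(F(r·)) → SF` pointwise, with local bounds, and a Montel-type argument
(`differentiable_of_tendsto_of_locally_bounded`) makes the limit entire. -/

open Filter Topology

/-! ### Limits of locally bounded sequences of entire functions. -/

/-- A pointwise limit of a locally bounded sequence of entire functions on a finite-dimensional
space is locally a uniform limit. -/
lemma uniformCauchySeqOn_of_tendsto_of_bounded {E : Type*} [NormedAddCommGroup E]
    [NormedSpace ℂ E] [ProperSpace E] {f : ℕ → E → ℂ} {g : E → ℂ}
    (hf : ∀ n, Differentiable ℂ (f n)) (hlim : ∀ z, Tendsto (fun n => f n z) atTop (𝓝 (g z)))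
    {x : E} {R M : ℝ} (hM : ∀ n, ∀ z ∈ Metric.ball x (R + 1), ‖f n z‖ ≤ M) :
    UniformCauchySeqOn f atTop (Metric.closedBall x R) := by
  -- Equicontinuity from the Schwarz lemma on unit balls. The oscillation is at most `2 * M`; the `+
  -- 1` keeps the constant positive when `M = 0`, as `δ` divides by it.
  have hlip : ∀ n, ∀ y ∈ Metric.closedBall x R, ∀ z ∈ Metric.ball y 1,
      dist (f n z) (f n y) ≤ (2 * M + 1) * dist z y := by
    intro n y hy z hz
    have hsub : ∀ z ∈ Metric.ball y 1, z ∈ Metric.ball x (R + 1) := fun z hz => by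
      rw [Metric.mem_ball] at hz ⊢
      rw [Metric.mem_closedBall] at hy
      linarith [dist_triangle z y x]
    have hmaps : Set.MapsTo (f n) (Metric.ball y 1) (Metric.closedBall (f n y) (2 * M + 1)) := by
      intro w hw
      rw [Metric.mem_closedBall, dist_eq_norm]
      have h1 := hM n w (hsub w hw)
      have h2 := hM n y (hsub y (Metric.mem_ball_self one_pos))
      linarith [norm_sub_le (f n w) (f n y)]
    simpa using Complex.dist_le_div_mul_dist_of_mapsTo_ball
      (hf n).differentiableOn hmaps hz
  rw [Metric.uniformCauchySeqOn_iff]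
  intro ε hε
  by_cases hne : (Metric.closedBall x R).Nonempty
  swap
  · rw [Set.not_nonempty_iff_eq_empty] at hne
    exact ⟨0, fun m _ n _ z hz => by simp [hne] at hz⟩
  have hM0 : 0 ≤ M := by
    have hR : 0 ≤ R := Metric.nonempty_closedBall.1 hne
    exact (norm_nonneg _).trans (hM 0 x (Metric.mem_ball_self (by linarith)))
  set δ := min 1 (ε / (4 * (2 * M + 1))) with hδ
  have hδ0 : 0 < δ := lt_min one_pos (by positivity)
  obtain ⟨t, htsub, htfin, ht⟩ :=
    Metric.finite_approx_of_totallyBounded (isCompact_closedBall x R).totallyBounded δ hδ0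
  have hev : ∀ y ∈ t, ∃ N, ∀ m ≥ N, ∀ n ≥ N, dist (f m y) (f n y) < ε / 2 := fun y _ =>
    Metric.cauchySeq_iff.1 (hlim y).cauchySeq (ε / 2) (by positivity)
  choose! N hN using hev
  obtain ⟨N₀, hN₀⟩ := (htfin.image N).bddAbove
  refine ⟨N₀, fun m hm n hn z hz => ?_⟩
  obtain ⟨y, hy, hzy⟩ := Set.mem_iUnion₂.1 (ht hz)
  have hNy : N y ≤ N₀ := hN₀ ⟨y, hy, rfl⟩
  rw [Metric.mem_ball] at hzy
  have hz1 : z ∈ Metric.ball y 1 := hzy.trans_le (min_le_left _ _)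
  have hbd : (2 * M + 1) * dist z y < ε / 4 := by
    have : dist z y < ε / (4 * (2 * M + 1)) := hzy.trans_le (min_le_right _ _)
    rw [lt_div_iff₀ (by positivity)] at this
    linarith
  have h1 := hlip m y (htsub hy) z hz1
  have h2 := hlip n y (htsub hy) z hz1
  have h3 := hN y hy m (hNy.trans hm) n (hNy.trans hn)
  have h4 := dist_triangle4 (f m z) (f m y) (f n y) (f n z)
  rw [dist_comm (f n y)] at h4
  linarith

/-- A pointwise limit of a locally bounded sequence of entire functions is entire. -/
lemma differentiable_of_tendsto_of_locally_bounded {E : Type*} [NormedAddCommGroup E]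
    [NormedSpace ℂ E] [ProperSpace E] {f : ℕ → E → ℂ} {g : E → ℂ}
    (hf : ∀ n, Differentiable ℂ (f n)) (hlim : ∀ z, Tendsto (fun n => f n z) atTop (𝓝 (g z)))
    (hbd : ∀ (x : E) (R : ℝ), ∃ M, ∀ n, ∀ z ∈ Metric.ball x R, ‖f n z‖ ≤ M) :
    Differentiable ℂ g := by
  intro x
  obtain ⟨M, hM⟩ := hbd x (2 + 1)
  have hC := uniformCauchySeqOn_of_tendsto_of_bounded hf hlim hM
  -- A Cauchy estimate on unit balls bounds the derivative of `f m - f n` by its oscillation, so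
  -- radius 2 for the functions yields radius 1 for the derivatives.
  have hC' : UniformCauchySeqOn (fun n => fderiv ℂ (f n)) atTop (Metric.ball x 1) := by
    rw [Metric.uniformCauchySeqOn_iff] at hC ⊢
    intro ε hε
    obtain ⟨N, hN⟩ := hC (ε / 4) (by positivity)
    refine ⟨N, fun m hm n hn z hz => ?_⟩
    rw [Metric.mem_ball] at hz
    have hsub : ∀ w ∈ Metric.ball z 1, ‖f m w - f n w‖ ≤ ε / 4 := fun w hw => by
      rw [← dist_eq_norm]
      refine (hN m hm n hn w ?_).le
      rw [Metric.mem_ball] at hw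
      rw [Metric.mem_closedBall]
      linarith [dist_triangle w z x]
    have hmaps : Set.MapsTo (f m - f n) (Metric.ball z 1)
        (Metric.closedBall ((f m - f n) z) (ε / 2)) := by
      intro w hw
      rw [Metric.mem_closedBall, dist_eq_norm]
      have h1 := hsub w hw
      have h2 := hsub z (Metric.mem_ball_self one_pos)
      have h3 := norm_sub_le (f m w - f n w) (f m z - f n z)
      simp only [Pi.sub_apply]
      linarith
    have h := Complex.norm_fderiv_le_div_of_mapsTo_ball
      ((hf m).sub (hf n)).differentiableOn hmaps one_pos
    rw [fderiv_sub (hf m z) (hf n z), div_one] at h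
    rw [dist_eq_norm]
    linarith
  have hlim' : ∀ z ∈ Metric.ball x 1, ∃ L, Tendsto (fun n => fderiv ℂ (f n) z) atTop (𝓝 L) :=
    fun z hz => cauchySeq_tendsto_of_complete (hC'.cauchySeq hz)
  choose! g' hg' using hlim'
  exact (hasFDerivAt_of_tendstoUniformlyOn Metric.isOpen_ball
    (hC'.tendstoUniformlyOn_of_tendsto hg') (fun n z _ => (hf n z).hasFDerivAt)
    (fun z _ => hlim z) (Metric.mem_ball_self one_pos)).differentiableAt

/-! ### Sub-mean value properties. -/

/-- The sub-mean value property of `‖G‖` on circles. -/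
lemma enorm_le_lintegral_circle {E : Type*} [NormedAddCommGroup E] [NormedSpace ℂ E]
    {G : E → ℂ} (hG : Differentiable ℂ G) (z u : E) :
    ENNReal.ofReal (2 * Real.pi) * ‖G z‖ₑ ≤
      ∫⁻ θ in Set.Ioc 0 (2 * Real.pi), ‖G (z + Complex.exp (θ * Complex.I) • u)‖ₑ := by
  have hd : Differentiable ℂ fun c : ℂ => G (z + c • u) :=
    hG.comp ((differentiable_const z).add (differentiable_id.smul_const u))
  have h := (hd.diffContOnCl (s := Metric.ball 0 |1|)).circleAverage
  rw [Real.circleAverage_def, zero_smul, add_zero] at h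
  simp only [circleMap_zero, Complex.ofReal_one, one_mul] at h
  have hpi : 0 < 2 * Real.pi := by positivity
  rw [inv_smul_eq_iff₀ hpi.ne', intervalIntegral.integral_of_le hpi.le] at h
  calc ENNReal.ofReal (2 * Real.pi) * ‖G z‖ₑ = ‖(2 * Real.pi) • G z‖ₑ := by
        rw [enorm_smul, Real.enorm_of_nonneg hpi.le]
    _ ≤ _ := by rw [← h]; exact enorm_integral_le_lintegral_enorm _

lemma measurePreserving_smul_exp_mul_I (d : ℕ) (θ : ℝ) :
    MeasurePreserving (fun u : Fin d → ℂ => Complex.exp (θ * Complex.I) • u) := by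
  refine volume_preserving_pi (f := fun _ (c : ℂ) => Complex.exp (θ * Complex.I) • c)
    fun _ => ?_
  have h : (fun c : ℂ => Complex.exp (θ * Complex.I) • c) = rotation (Circle.exp θ) := by
    ext c
    simp
  rw [h]
  exact (rotation (Circle.exp θ)).measurePreserving

/-- The sub-mean value property of `‖G‖` on polydiscs. -/
lemma volume_mul_enorm_le_lintegral_ball {d : ℕ} {G : (Fin d → ℂ) → ℂ} (hG : Differentiable ℂ G)
    (z : Fin d → ℂ) :
    volume (Metric.ball (0 : Fin d → ℂ) 1) * ‖G z‖ₑ ≤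
      ∫⁻ u in Metric.ball (0 : Fin d → ℂ) 1, ‖G (z + u)‖ₑ := by
  have hpi : 0 < 2 * Real.pi := by positivity
  have hc := hG.continuous
  set B := Metric.ball (0 : Fin d → ℂ) 1 with hB
  -- The sup-norm ball is a polydisc, invariant under rotating all coordinates by the same angle, so
  -- the average over `θ` becomes trivial after Tonelli.
  have hrot : ∀ θ : ℝ, ∫⁻ u in B, ‖G (z + Complex.exp (θ * Complex.I) • u)‖ₑ =
      ∫⁻ u in B, ‖G (z + u)‖ₑ := by
    intro θ
    have hpre : (fun u : Fin d → ℂ => Complex.exp (θ * Complex.I) • u) ⁻¹' B = B := by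
      ext u
      simp [hB, norm_smul, Complex.norm_exp_ofReal_mul_I]
    have h := (measurePreserving_smul_exp_mul_I d θ).setLIntegral_comp_preimage
      (s := B) Metric.isOpen_ball.measurableSet (f := fun u => ‖G (z + u)‖ₑ)
      (by exact (hc.comp (continuous_const_add z)).enorm.measurable)
    rwa [hpre] at h
  have h : ENNReal.ofReal (2 * Real.pi) * (volume B * ‖G z‖ₑ) ≤
      ENNReal.ofReal (2 * Real.pi) * ∫⁻ u in B, ‖G (z + u)‖ₑ := by
    calc ENNReal.ofReal (2 * Real.pi) * (volume B * ‖G z‖ₑ)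
        = ∫⁻ _ in B, ENNReal.ofReal (2 * Real.pi) * ‖G z‖ₑ := by
          rw [setLIntegral_const]; ring
      _ ≤ ∫⁻ u in B, ∫⁻ θ in Set.Ioc 0 (2 * Real.pi),
            ‖G (z + Complex.exp (θ * Complex.I) • u)‖ₑ :=
          lintegral_mono fun u => enorm_le_lintegral_circle hG z u
      _ = ∫⁻ θ in Set.Ioc 0 (2 * Real.pi), ∫⁻ u in B,
            ‖G (z + Complex.exp (θ * Complex.I) • u)‖ₑ := by
          refine lintegral_lintegral_swap (Continuous.aemeasurable ?_)
          unfold Function.uncurry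
          fun_prop
      _ = ENNReal.ofReal (2 * Real.pi) * ∫⁻ u in B, ‖G (z + u)‖ₑ := by
          simp_rw [hrot]
          rw [setLIntegral_const, Real.volume_Ioc, sub_zero, mul_comm]
  exact (ENNReal.mul_le_mul_iff_right (by simpa using hpi) ENNReal.ofReal_ne_top).1 h

/-! ### Young's inequality. -/

/-- **Young's inequality** `‖g * h‖_q ≤ ‖g‖_q ‖h‖_1`, for nonnegative functions. -/
lemma lintegral_rpow_lintegral_mul_le {G : Type*} [AddGroup G] [MeasurableSpace G]
    [MeasurableAdd₂ G] {μ : Measure G} [SFinite μ] [μ.IsAddRightInvariant]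
    {g h : G → ℝ≥0∞} (hg : Measurable g) (hh : AEMeasurable h μ) {q : ℝ} (hq : 1 ≤ q) :
    ∫⁻ z, (∫⁻ u, g (z + u) * h u ∂μ) ^ q ∂μ ≤ (∫⁻ u, h u ∂μ) ^ q * ∫⁻ z, g z ^ q ∂μ := by
  have hq0 : 0 < q := by linarith
  have hb : 0 ≤ 1 - q⁻¹ := sub_nonneg.2 (inv_le_one_of_one_le₀ hq)
  have hpt : ∀ z, (∫⁻ u, g (z + u) * h u ∂μ) ^ q ≤
      (∫⁻ u, g (z + u) ^ q * h u ∂μ) * (∫⁻ u, h u ∂μ) ^ (q - 1) := by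
    intro z
    have hgz : AEMeasurable (fun u => g (z + u)) μ :=
      (hg.comp (measurable_const_add z)).aemeasurable
    -- Hölder for the splitting `g h = (g^q h)^{1/q} h^{1-1/q}`.
    have hH := ENNReal.lintegral_mul_norm_pow_le (μ := μ)
      (f := fun u => g (z + u) ^ q * h u) (g := h) ((hgz.pow_const q).mul hh) hh
      (inv_nonneg.2 hq0.le) hb (by ring)
    have heq : ∀ u, (g (z + u) ^ q * h u) ^ q⁻¹ * h u ^ (1 - q⁻¹) = g (z + u) * h u := by
      intro u
      rw [ENNReal.mul_rpow_of_nonneg _ _ (inv_nonneg.2 hq0.le), ← ENNReal.rpow_mul,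
        mul_inv_cancel₀ hq0.ne', ENNReal.rpow_one, mul_assoc,
        ← ENNReal.rpow_add_of_nonneg _ _ (inv_nonneg.2 hq0.le) hb, add_sub_cancel,
        ENNReal.rpow_one]
    simp_rw [heq] at hH
    refine (ENNReal.rpow_le_rpow hH hq0.le).trans_eq ?_
    rw [ENNReal.mul_rpow_of_nonneg _ _ hq0.le, ← ENNReal.rpow_mul, ← ENNReal.rpow_mul,
      inv_mul_cancel₀ hq0.ne', ENNReal.rpow_one, sub_mul, inv_mul_cancel₀ hq0.ne', one_mul]
  calc ∫⁻ z, (∫⁻ u, g (z + u) * h u ∂μ) ^ q ∂μ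
      ≤ ∫⁻ z, (∫⁻ u, g (z + u) ^ q * h u ∂μ) * (∫⁻ u, h u ∂μ) ^ (q - 1) ∂μ :=
        lintegral_mono hpt
    _ = (∫⁻ z, ∫⁻ u, g (z + u) ^ q * h u ∂μ ∂μ) * (∫⁻ u, h u ∂μ) ^ (q - 1) := by
        refine lintegral_mul_const'' _ (AEMeasurable.lintegral_prod_right' (f := fun x : G × G =>
          g (x.1 + x.2) ^ q * h x.2) ?_)
        exact (((hg.comp measurable_add).pow_const q).aemeasurable).mul hh.comp_snd
    _ = (∫⁻ u, ∫⁻ z, g (z + u) ^ q * h u ∂μ ∂μ) * (∫⁻ u, h u ∂μ) ^ (q - 1) := by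
        rw [lintegral_lintegral_swap]
        exact (((hg.comp measurable_add).pow_const q).aemeasurable).mul hh.comp_snd
    _ = (∫⁻ u, (∫⁻ z, g z ^ q ∂μ) * h u ∂μ) * (∫⁻ u, h u ∂μ) ^ (q - 1) := by
        congr 1
        refine lintegral_congr fun u => ?_
        rw [lintegral_mul_const (h u) (f := fun z => g (z + u) ^ q)
            ((hg.comp (measurable_add_const u)).pow_const q),
          lintegral_add_right_eq_self (fun z => g z ^ q) u]
    _ = (∫⁻ u, h u ∂μ) ^ q * ∫⁻ z, g z ^ q ∂μ := by
        rw [lintegral_const_mul'' _ hh, mul_assoc, mul_comm]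
        congr 1
        nth_rewrite 1 [← ENNReal.rpow_one (∫⁻ u, h u ∂μ)]
        rw [← ENNReal.rpow_add_of_nonneg _ _ zero_le_one (by linarith), add_sub_cancel]

/-! ### The Gaussian weight and pointwise bounds in Fock spaces. -/

lemma continuous_absSq (d : ℕ) : Continuous (absSq : (Fin d → ℂ) → ℝ) := by
  unfold absSq
  fun_prop

lemma absSq_nonneg {d : ℕ} (z : Fin d → ℂ) : 0 ≤ absSq z :=
  Finset.sum_nonneg fun _ _ => by positivity

lemma absSq_smul {d : ℕ} (r : ℝ) (z : Fin d → ℂ) : absSq ((r : ℂ) • z) = r ^ 2 * absSq z := by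
  simp [absSq, mul_pow, Finset.mul_sum]

lemma absSq_add {d : ℕ} (z u : Fin d → ℂ) :
    absSq (z + u) = absSq z + absSq u + 2 * (u ⬝ᵥ star z).re := by
  simp only [absSq, dotProduct, Complex.re_sum, Finset.mul_sum, ← Finset.sum_add_distrib]
  refine Finset.sum_congr rfl fun i _ => ?_
  simp only [← Complex.normSq_eq_norm_sq, Pi.add_apply, Pi.star_apply, Complex.normSq_apply,
    Complex.add_re, Complex.add_im, Complex.mul_re, RCLike.star_def, Complex.conj_re,
    Complex.conj_im]
  ring

lemma absSq_le_of_mem_ball {d : ℕ} {u : Fin d → ℂ} (hu : u ∈ Metric.ball (0 : Fin d → ℂ) 1) :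
    absSq u ≤ d := by
  rw [mem_ball_zero_iff] at hu
  calc absSq u ≤ ∑ _i : Fin d, (1 : ℝ) := by
        refine Finset.sum_le_sum fun i _ => ?_
        have h1 : ‖u i‖ ≤ 1 := (norm_le_pi_norm u i).trans hu.le
        exact pow_le_one₀ (norm_nonneg _) h1
    _ = d := by simp

lemma continuous_gaussWeighted {d : ℕ} {F : (Fin d → ℂ) → ℂ} (hF : Continuous F) :
    Continuous (gaussWeighted F) := by
  have := continuous_absSq d
  unfold gaussWeighted
  fun_prop

lemma norm_gaussWeighted {d : ℕ} (F : (Fin d → ℂ) → ℂ) (z : Fin d → ℂ) :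
    ‖gaussWeighted F z‖ = ‖F z‖ * Real.exp (-(Real.pi * absSq z / 2)) := by
  rw [gaussWeighted, norm_mul, Complex.norm_real, Real.norm_of_nonneg (Real.exp_pos _).le]

/-- Pointwise values of a weighted entire function are controlled by its local means. -/
lemma volume_mul_enorm_gaussWeighted_le {d : ℕ} {F : (Fin d → ℂ) → ℂ} (hF : Differentiable ℂ F)
    (z : Fin d → ℂ) :
    volume (Metric.ball (0 : Fin d → ℂ) 1) * ‖gaussWeighted F z‖ₑ ≤
      ENNReal.ofReal (Real.exp (Real.pi * d / 2)) *
        ∫⁻ u in Metric.ball (0 : Fin d → ℂ) 1, ‖gaussWeighted F (z + u)‖ₑ := by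
  -- An entire replacement for the weight near `z`: expanding `|z+u|²` gives `|G(z+u)| = |F(z+u)|
  -- e^{-π|z+u|²/2} e^{π|u|²/2}`, and `|u|² ≤ d` on the polydisc.
  set G : (Fin d → ℂ) → ℂ := fun v =>
    F v * Complex.exp (-(Real.pi * ((v - z) ⬝ᵥ star z))) *
      (Real.exp (-(Real.pi * absSq z / 2)) : ℂ) with hGdef
  have hG : Differentiable ℂ G := by
    have : Differentiable ℂ fun v : Fin d → ℂ => (v - z) ⬝ᵥ star z := by
      unfold dotProduct
      fun_prop
    fun_prop
  have hGz : G z = gaussWeighted F z := by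
    simp [hGdef, gaussWeighted]
  have hGu : ∀ u ∈ Metric.ball (0 : Fin d → ℂ) 1,
      ‖G (z + u)‖ₑ ≤ ENNReal.ofReal (Real.exp (Real.pi * d / 2)) * ‖gaussWeighted F (z + u)‖ₑ := by
    intro u hu
    rw [← ofReal_norm, ← ofReal_norm, ← ENNReal.ofReal_mul (Real.exp_pos _).le]
    refine ENNReal.ofReal_le_ofReal ?_
    rw [norm_gaussWeighted, hGdef]
    simp only [add_sub_cancel_left, norm_mul, Complex.norm_exp, Complex.norm_real,
      Real.norm_of_nonneg (Real.exp_pos _).le, Complex.neg_re, Complex.re_ofReal_mul]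
    rw [mul_assoc, ← Real.exp_add, mul_left_comm, ← Real.exp_add]
    refine mul_le_mul_of_nonneg_left (Real.exp_le_exp.2 ?_) (norm_nonneg _)
    rw [absSq_add]
    nlinarith [mul_le_mul_of_nonneg_left (absSq_le_of_mem_ball hu) Real.pi_pos.le]
  rw [← hGz]
  refine (volume_mul_enorm_le_lintegral_ball hG z).trans ?_
  refine (setLIntegral_mono' Metric.isOpen_ball.measurableSet hGu).trans_eq ?_
  exact lintegral_const_mul' _ _ ENNReal.ofReal_ne_top

/-- `𝓕^p ⊆ 𝓕^∞`: weighted Fock space functions are bounded everywhere. -/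
lemma exists_norm_gaussWeighted_le {d : ℕ} {p : ℝ≥0∞} (hp : 1 ≤ p) (F : fockSpace d p) :
    ∃ C : ℝ, ∀ z, ‖gaussWeighted (F : (Fin d → ℂ) → ℂ) z‖ ≤ C := by
  obtain ⟨F, hF, hFp⟩ := F
  set B := Metric.ball (0 : Fin d → ℂ) 1 with hB
  have hV0 : volume B ≠ 0 := (Metric.measure_ball_pos _ _ one_pos).ne'
  have hVt : volume B ≠ ∞ := measure_ball_lt_top.ne
  have hcont := continuous_gaussWeighted hF.continuous
  -- The power of the volume comes from Hölder on the ball. For `p = ∞`, `p.toReal = 0` and `1 / 0 =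
  -- 0` give the correct exponent 1.
  set K : ℝ≥0∞ := ENNReal.ofReal (Real.exp (Real.pi * d / 2)) *
    (eLpNorm (gaussWeighted F) p volume * volume B ^ (1 / (1 : ℝ≥0∞).toReal - 1 / p.toReal))
    with hK
  have hexp : 0 ≤ 1 / (1 : ℝ≥0∞).toReal - 1 / p.toReal := by
    rcases eq_or_ne p ∞ with rfl | hpt
    · simp
    · have : 1 ≤ p.toReal := by simpa using ENNReal.toReal_mono hpt hp
      simpa using inv_le_one_of_one_le₀ this
  have hKt : K ≠ ∞ := ENNReal.mul_ne_top ENNReal.ofReal_ne_top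
    (ENNReal.mul_ne_top hFp.2.ne (ENNReal.rpow_ne_top_of_nonneg hexp hVt))
  have hmain : ∀ z, volume B * ‖gaussWeighted F z‖ₑ ≤ K := by
    intro z
    refine (volume_mul_enorm_gaussWeighted_le hF z).trans (mul_le_mul_right ?_ _)
    have hsm : AEStronglyMeasurable (fun u => gaussWeighted F (z + u)) (volume.restrict B) :=
      (hcont.comp (continuous_const_add z)).aestronglyMeasurable
    have h := eLpNorm_le_eLpNorm_mul_rpow_measure_univ hp hsm
    rw [eLpNorm_one_eq_lintegral_enorm, Measure.restrict_apply_univ] at h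
    have htr : eLpNorm (fun u => gaussWeighted F (z + u)) p volume =
        eLpNorm (gaussWeighted F) p volume :=
      eLpNorm_comp_measurePreserving (g := gaussWeighted F) (f := fun u => z + u) (p := p)
        hcont.aestronglyMeasurable (measurePreserving_add_left volume z)
    refine h.trans (mul_le_mul_left ?_ _)
    exact htr ▸ eLpNorm_restrict_le _ _ _ _
  refine ⟨(K / volume B).toReal, fun z => ?_⟩
  have h : ‖gaussWeighted F z‖ₑ ≤ K / volume B := by
    rw [ENNReal.le_div_iff_mul_le (Or.inl hV0) (Or.inl hVt), mul_comm]
    exact hmain z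
  have := ENNReal.toReal_mono (ENNReal.div_ne_top hKt hV0) h
  rwa [toReal_enorm] at this

/-! ### Dilations. -/

lemma integrable_exp_neg_mul_absSq (d : ℕ) {b : ℝ} (hb : 0 < b) :
    Integrable (fun z : Fin d → ℂ => Real.exp (-(b * absSq z))) := by
  have h1 : Integrable (fun c : ℂ => Real.exp (-(b * ‖c‖ ^ 2))) := by
    have h := (GaussianFourier.integrable_cexp_neg_mul_sq_norm_add (V := ℂ) (b := b)
      (by simpa using hb) 0 0).norm
    refine h.congr (Eventually.of_forall fun c => ?_)
    simp only [inner_zero_left, Complex.ofReal_zero, mul_zero, add_zero, Complex.norm_exp]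
    congr 1
    rw [← Complex.ofReal_pow, ← Complex.ofReal_neg, ← Complex.ofReal_mul, Complex.ofReal_re]
    ring
  refine (Integrable.fintype_prod (μ := fun _ => volume) (f := fun (_ : Fin d) (c : ℂ) =>
    Real.exp (-(b * ‖c‖ ^ 2))) fun _ => h1).congr (Eventually.of_forall fun z => ?_)
  simp only [absSq]
  rw [← Real.exp_sum, Finset.sum_neg_distrib, Finset.mul_sum]

/-- Dilating `F` but not the weight leaves a spare Gaussian. For `0 ≤ r < 1` it is integrable, which
puts dilates in `𝓕^1`, and at most 1, which makes their bounds uniform in `r`. -/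
lemma gaussWeighted_dilate {d : ℕ} (F : (Fin d → ℂ) → ℂ) (r : ℝ) (z : Fin d → ℂ) :
    ‖gaussWeighted (fun w => F ((r : ℂ) • w)) z‖ =
      ‖gaussWeighted F ((r : ℂ) • z)‖ * Real.exp (-(Real.pi * (1 - r ^ 2) / 2 * absSq z)) := by
  rw [norm_gaussWeighted, norm_gaussWeighted, mul_assoc, ← Real.exp_add, absSq_smul]
  congr 2
  ring

/-- Dilates of functions in `𝓕^p` by a factor less than one lie in `𝓕^1`. -/
lemma dilate_mem_fockSpace_one {d : ℕ} {F : (Fin d → ℂ) → ℂ} (hF : Differentiable ℂ F) {C : ℝ}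
    (hC : ∀ z, ‖gaussWeighted F z‖ ≤ C) {r : ℝ} (hr0 : 0 ≤ r) (hr1 : r < 1) :
    (fun w => F ((r : ℂ) • w)) ∈ fockSpace d 1 := by
  have hd : Differentiable ℂ (fun w => F ((r : ℂ) • w)) :=
    hF.comp (differentiable_id.const_smul (r : ℂ))
  refine ⟨hd, memLp_one_iff_integrable.2 ?_⟩
  have hb : 0 < Real.pi * (1 - r ^ 2) / 2 := by
    have : 0 < 1 - r ^ 2 := by nlinarith
    positivity
  refine ((integrable_exp_neg_mul_absSq d hb).const_mul C).mono'
    (continuous_gaussWeighted hd.continuous).aestronglyMeasurable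
    (Eventually.of_forall fun z => ?_)
  rw [gaussWeighted_dilate]
  exact mul_le_mul_of_nonneg_right (hC _) (Real.exp_pos _).le

lemma norm_gaussWeighted_dilate_le {d : ℕ} {F : (Fin d → ℂ) → ℂ} {C : ℝ}
    (hC : ∀ z, ‖gaussWeighted F z‖ ≤ C) {r : ℝ} (hr0 : 0 ≤ r) (hr1 : r < 1) (z : Fin d → ℂ) :
    ‖gaussWeighted (fun w => F ((r : ℂ) • w)) z‖ ≤ C := by
  rw [gaussWeighted_dilate]
  refine (mul_le_of_le_one_right (norm_nonneg _) (Real.exp_le_one_iff.2 ?_)).trans (hC _)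
  have h1 : 0 ≤ 1 - r ^ 2 := by nlinarith
  have h2 := absSq_nonneg z
  have : 0 ≤ Real.pi * (1 - r ^ 2) / 2 * absSq z := by positivity
  linarith

/-! ### The integral operator under the kernel bound. -/

lemma measurePreserving_star (d : ℕ) : MeasurePreserving (star : (Fin d → ℂ) → (Fin d → ℂ)) :=
  volume_preserving_pi (f := fun _ => Complex.conjLIE) fun _ =>
    Complex.conjLIE.measurePreserving

lemma aestronglyMeasurable_fockIntegrand {d : ℕ} {φ F : (Fin d → ℂ) → ℂ}
    (hφ : AEStronglyMeasurable φ volume) (hF : Continuous F) (z : Fin d → ℂ) :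
    AEStronglyMeasurable (fockIntegrand φ F z) volume := by
  have h1 : AEStronglyMeasurable (fun w : Fin d → ℂ => φ (star w - z)) volume :=
    hφ.comp_measurePreserving
      ((measurePreserving_sub_right volume z).comp (measurePreserving_star d))
  have h2 : Continuous fun w : Fin d → ℂ => Complex.exp (Real.pi * (z ⬝ᵥ star w)) := by
    unfold dotProduct
    fun_prop
  have h3 : Continuous fun w : Fin d → ℂ => (Real.exp (-(Real.pi * absSq w)) : ℂ) := by
    have := continuous_absSq d
    fun_prop
  exact ((hF.mul h2).aestronglyMeasurable.mul h1).mul h3.aestronglyMeasurable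

/-- The growth condition on the symbol `φ`: `|φ(z̄ - w)| ≤ e^{π|z - w|²/2} H(z - w)`. -/
def KernelBound {d : ℕ} (φ : (Fin d → ℂ) → ℂ) (H : (Fin d → ℂ) → ℝ) : Prop :=
  ∀ z w : Fin d → ℂ,
    ‖φ (star z - w)‖ ≤
      ‖Complex.exp (Real.pi * ((absSq z + absSq w : ℝ) : ℂ) / 2
        - Real.pi * (w ⬝ᵥ star z))‖ * H (z - w)

lemma KernelBound.nonneg {d : ℕ} {φ : (Fin d → ℂ) → ℂ} {H : (Fin d → ℂ) → ℝ}
    (hb : KernelBound φ H) (u : Fin d → ℂ) : 0 ≤ H u := by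
  have h := (norm_nonneg _).trans (hb u 0)
  rw [sub_zero] at h
  exact nonneg_of_mul_nonneg_right h (norm_pos_iff.2 (Complex.exp_ne_zero _))

/-- The terms in `Re (z · w̄)` cancel between the kernel and the bound on `φ`; what remains of the
exponent is `π|z|²/2 - π|w|²/2`, whose second half is the weight of `F`. -/
lemma KernelBound.norm_fockIntegrand_le {d : ℕ} {φ : (Fin d → ℂ) → ℂ} {H : (Fin d → ℂ) → ℝ}
    (hb : KernelBound φ H) (F : (Fin d → ℂ) → ℂ) (z w : Fin d → ℂ) :
    ‖fockIntegrand φ F z w‖ ≤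
      Real.exp (Real.pi * absSq z / 2) * (‖gaussWeighted F w‖ * H (w - z)) := by
  have h := hb w z
  have hre : (Real.pi * ((absSq w + absSq z : ℝ) : ℂ) / 2 - Real.pi * (z ⬝ᵥ star w)).re =
      Real.pi * (absSq w + absSq z) / 2 - Real.pi * (z ⬝ᵥ star w).re := by
    rw [Complex.sub_re, Complex.re_ofReal_mul, ← Complex.ofReal_mul,
      show (2 : ℂ) = ((2 : ℝ) : ℂ) by norm_num, ← Complex.ofReal_div, Complex.ofReal_re]
  rw [Complex.norm_exp, hre] at h
  rw [norm_gaussWeighted, fockIntegrand]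
  simp only [norm_mul, Complex.norm_exp, Complex.norm_real,
      Real.norm_of_nonneg (Real.exp_pos _).le, Complex.re_ofReal_mul]
  calc ‖F w‖ * Real.exp (Real.pi * (z ⬝ᵥ star w).re) * ‖φ (star w - z)‖ *
        Real.exp (-(Real.pi * absSq w))
      ≤ ‖F w‖ * Real.exp (Real.pi * (z ⬝ᵥ star w).re) *
        (Real.exp (Real.pi * (absSq w + absSq z) / 2 - Real.pi * (z ⬝ᵥ star w).re) *
          H (w - z)) * Real.exp (-(Real.pi * absSq w)) := by gcongr
    _ = ‖F w‖ * (Real.exp (Real.pi * (z ⬝ᵥ star w).re) *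
        Real.exp (Real.pi * (absSq w + absSq z) / 2 - Real.pi * (z ⬝ᵥ star w).re) *
          Real.exp (-(Real.pi * absSq w))) * H (w - z) := by ring
    _ = ‖F w‖ * (Real.exp (Real.pi * absSq z / 2) * Real.exp (-(Real.pi * absSq w / 2))) *
          H (w - z) := by
        rw [← Real.exp_add, ← Real.exp_add, ← Real.exp_add]
        congr 3
        ring
    _ = _ := by ring

lemma KernelBound.norm_fockIntegrand_le_of_bounded {d : ℕ} {φ : (Fin d → ℂ) → ℂ}
    {H : (Fin d → ℂ) → ℝ} (hb : KernelBound φ H) {F : (Fin d → ℂ) → ℂ} {C : ℝ}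
    (hC : ∀ z, ‖gaussWeighted F z‖ ≤ C) (z w : Fin d → ℂ) :
    ‖fockIntegrand φ F z w‖ ≤ Real.exp (Real.pi * absSq z / 2) * (C * H (w - z)) :=
  (hb.norm_fockIntegrand_le F z w).trans (mul_le_mul_of_nonneg_left
    (mul_le_mul_of_nonneg_right (hC w) (hb.nonneg _)) (Real.exp_pos _).le)

lemma KernelBound.integrable_fockIntegrand {d : ℕ} {φ : (Fin d → ℂ) → ℂ} {H : (Fin d → ℂ) → ℝ}
    (hb : KernelBound φ H) (hφ : AEStronglyMeasurable φ volume) (hH : Integrable H volume)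
    {F : (Fin d → ℂ) → ℂ} (hF : Continuous F) {C : ℝ} (hC : ∀ z, ‖gaussWeighted F z‖ ≤ C)
    (z : Fin d → ℂ) : Integrable (fockIntegrand φ F z) volume :=
  (((hH.comp_sub_right z).const_mul C).const_mul _).mono'
    (aestronglyMeasurable_fockIntegrand hφ hF z)
    (Eventually.of_forall (hb.norm_fockIntegrand_le_of_bounded hC z))

lemma KernelBound.norm_integral_fockIntegrand_le {d : ℕ} {φ : (Fin d → ℂ) → ℂ}
    {H : (Fin d → ℂ) → ℝ} (hb : KernelBound φ H) (hH : Integrable H volume)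
    {F : (Fin d → ℂ) → ℂ} {C : ℝ} (hC : ∀ z, ‖gaussWeighted F z‖ ≤ C) (z : Fin d → ℂ) :
    ‖∫ w, fockIntegrand φ F z w‖ ≤ Real.exp (Real.pi * absSq z / 2) * (C * ∫ u, H u) := by
  refine (norm_integral_le_of_norm_le (((hH.comp_sub_right z).const_mul C).const_mul _)
    (Eventually.of_forall (hb.norm_fockIntegrand_le_of_bounded hC z))).trans_eq ?_
  rw [integral_const_mul, integral_const_mul, integral_sub_right_eq_self H z]

/-- The integral operator maps functions with bounded weighted values to entire functions, as soon
as it does so for functions in `𝓕^1`. -/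
lemma KernelBound.differentiable_integral {d : ℕ} {φ : (Fin d → ℂ) → ℂ} {H : (Fin d → ℂ) → ℝ}
    (hb : KernelBound φ H) (hφ : AEStronglyMeasurable φ volume) (hH : Integrable H volume)
    (hone : ∀ F ∈ fockSpace d 1, Differentiable ℂ fun z => ∫ w, fockIntegrand φ F z w)
    {F : (Fin d → ℂ) → ℂ} (hF : Differentiable ℂ F) {C : ℝ}
    (hC : ∀ z, ‖gaussWeighted F z‖ ≤ C) :
    Differentiable ℂ fun z => ∫ w, fockIntegrand φ F z w := by
  set r : ℕ → ℝ := fun n => 1 - 1 / ((n : ℝ) + 1) with hr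
  have hr0 : ∀ n, 0 ≤ r n := fun n => by
    have : 1 / ((n : ℝ) + 1) ≤ 1 := by
      rw [div_le_one (by positivity)]
      linarith [n.cast_nonneg (α := ℝ)]
    simpa [hr] using this
  have hr1 : ∀ n, r n < 1 := fun n => by
    have : 0 < 1 / ((n : ℝ) + 1) := by positivity
    simp only [hr]
    linarith
  have hrlim : Tendsto r atTop (𝓝 1) := by
    simpa [hr] using tendsto_one_div_add_atTop_nhds_zero_nat.const_sub (1 : ℝ)
  set Fr : ℕ → (Fin d → ℂ) → ℂ := fun n w => F ((r n : ℂ) • w) with hFr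
  have hFr1 : ∀ n, Fr n ∈ fockSpace d 1 := fun n =>
    dilate_mem_fockSpace_one hF hC (hr0 n) (hr1 n)
  have hFrC : ∀ n z, ‖gaussWeighted (Fr n) z‖ ≤ C := fun n =>
    norm_gaussWeighted_dilate_le hC (hr0 n) (hr1 n)
  refine differentiable_of_tendsto_of_locally_bounded (fun n => hone (Fr n) (hFr1 n)) ?_ ?_
  · intro z
    refine tendsto_integral_of_dominated_convergence _
      (fun n => aestronglyMeasurable_fockIntegrand hφ (hFr1 n).1.continuous z)
      (((hH.comp_sub_right z).const_mul C).const_mul _)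
      (fun n => Eventually.of_forall (hb.norm_fockIntegrand_le_of_bounded (hFrC n) z))
      (Eventually.of_forall fun w => ?_)
    have h1 : Tendsto (fun n => Fr n w) atTop (𝓝 (F w)) := by
      have h2 : Tendsto (fun n => (r n : ℂ) • w) atTop (𝓝 w) := by
        have := ((Complex.continuous_ofReal.tendsto 1).comp hrlim).smul_const w
        simpa using this
      exact (hF.continuous.tendsto w).comp h2
    unfold fockIntegrand
    exact ((h1.mul_const _).mul_const _).mul_const _
  -- The bound depends on the dilate only through `C`, hence is uniform in `n`, and it is continuous
  -- in `z`.
  · intro x R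
    have hcont : Continuous fun z : Fin d → ℂ =>
        Real.exp (Real.pi * absSq z / 2) * (C * ∫ u, H u) := by
      have := continuous_absSq d
      fun_prop
    obtain ⟨M, hM⟩ := (isCompact_closedBall x R).bddAbove_image hcont.continuousOn
    exact ⟨M, fun n z hz => (hb.norm_integral_fockIntegrand_le hH (hFrC n) z).trans
      (hM ⟨z, Metric.ball_subset_closedBall hz, rfl⟩)⟩

/-- The weight at `z` cancels the factor `e^{π|z|²/2}` of the kernel estimate, and `w = z + u`
exhibits a convolution. -/
lemma KernelBound.enorm_gaussWeighted_integral_le {d : ℕ} {φ : (Fin d → ℂ) → ℂ}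
    {H : (Fin d → ℂ) → ℝ} (hb : KernelBound φ H) (F : (Fin d → ℂ) → ℂ) (z : Fin d → ℂ) :
    ‖gaussWeighted (fun z => ∫ w, fockIntegrand φ F z w) z‖ₑ ≤
      ∫⁻ u, ‖gaussWeighted F (z + u)‖ₑ * ‖H u‖ₑ := by
  have hpt : ∀ w, ‖fockIntegrand φ F z w‖ₑ ≤
      ENNReal.ofReal (Real.exp (Real.pi * absSq z / 2)) *
        (‖gaussWeighted F w‖ₑ * ‖H (w - z)‖ₑ) := by
    intro w
    rw [← ofReal_norm, ← ofReal_norm, Real.enorm_of_nonneg (hb.nonneg _),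
      ← ENNReal.ofReal_mul (norm_nonneg _), ← ENNReal.ofReal_mul (Real.exp_pos _).le]
    exact ENNReal.ofReal_le_ofReal (hb.norm_fockIntegrand_le F z w)
  calc ‖gaussWeighted (fun z => ∫ w, fockIntegrand φ F z w) z‖ₑ
      = ‖∫ w, fockIntegrand φ F z w‖ₑ *
          ENNReal.ofReal (Real.exp (-(Real.pi * absSq z / 2))) := by
        rw [← ofReal_norm, ← ofReal_norm, norm_gaussWeighted, ENNReal.ofReal_mul (norm_nonneg _)]
    _ ≤ (∫⁻ w, ENNReal.ofReal (Real.exp (Real.pi * absSq z / 2)) *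
          (‖gaussWeighted F w‖ₑ * ‖H (w - z)‖ₑ)) *
          ENNReal.ofReal (Real.exp (-(Real.pi * absSq z / 2))) := by
        gcongr
        exact (enorm_integral_le_lintegral_enorm _).trans (lintegral_mono hpt)
    _ = ∫⁻ w, ‖gaussWeighted F w‖ₑ * ‖H (w - z)‖ₑ := by
        rw [lintegral_const_mul' _ _ ENNReal.ofReal_ne_top, mul_right_comm,
          ← ENNReal.ofReal_mul (Real.exp_pos _).le, ← Real.exp_add, add_neg_cancel, Real.exp_zero,
          ENNReal.ofReal_one, one_mul]
    _ = ∫⁻ u, ‖gaussWeighted F (z + u)‖ₑ * ‖H u‖ₑ := by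
        rw [← lintegral_add_left_eq_self _ z]
        simp_rw [add_sub_cancel_left]

/-- The norm estimate `‖SF‖_{𝓕^p} ≤ ‖H‖_1 ‖F‖_{𝓕^p}`. -/
lemma KernelBound.fockNorm_integral_le {d : ℕ} {φ : (Fin d → ℂ) → ℂ} {H : (Fin d → ℂ) → ℝ}
    (hb : KernelBound φ H) (hH : Integrable H volume) {F : (Fin d → ℂ) → ℂ} (hF : Continuous F)
    {p : ℝ≥0∞} (hp : 1 ≤ p) :
    fockNorm p (fun z => ∫ w, fockIntegrand φ F z w) ≤
      (∫⁻ u, ‖H u‖ₑ) * fockNorm p F := by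
  have hcont := continuous_gaussWeighted hF
  have hHm : AEMeasurable (fun u => ‖H u‖ₑ) := hH.1.enorm
  unfold fockNorm
  rcases eq_or_ne p ∞ with rfl | hpt
  · rw [eLpNorm_exponent_top, eLpNorm_exponent_top]
    refine eLpNormEssSup_le_of_ae_enorm_bound (Eventually.of_forall fun z => ?_)
    refine (hb.enorm_gaussWeighted_integral_le F z).trans ?_
    rw [mul_comm, ← lintegral_const_mul'' _ hHm]
    refine lintegral_mono_ae ?_
    have hae := (measurePreserving_add_left volume z).quasiMeasurePreserving.ae
      (ae_le_eLpNormEssSup (f := gaussWeighted F) (μ := volume))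
    filter_upwards [hae] with u hu
    gcongr
  · have hp0 : p ≠ 0 := (one_pos.trans_le hp).ne'
    have hq : 1 ≤ p.toReal := by simpa using ENNReal.toReal_mono hpt hp
    have hq0 : 0 < p.toReal := by linarith
    rw [eLpNorm_eq_lintegral_rpow_enorm_toReal hp0 hpt,
      eLpNorm_eq_lintegral_rpow_enorm_toReal hp0 hpt]
    have h : ∫⁻ z, ‖gaussWeighted (fun z => ∫ w, fockIntegrand φ F z w) z‖ₑ ^ p.toReal ≤
        (∫⁻ u, ‖H u‖ₑ) ^ p.toReal * ∫⁻ z, ‖gaussWeighted F z‖ₑ ^ p.toReal :=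
      (lintegral_mono fun z => ENNReal.rpow_le_rpow
        (hb.enorm_gaussWeighted_integral_le F z) hq0.le).trans
        (lintegral_rpow_lintegral_mul_le hcont.enorm.measurable hHm hq)
    refine (ENNReal.rpow_le_rpow h (by positivity)).trans_eq ?_
    rw [ENNReal.mul_rpow_of_nonneg _ _ (by positivity), ← ENNReal.rpow_mul,
      mul_one_div_cancel hq0.ne', ENNReal.rpow_one]

/-! ### Linearity and the operator on `𝓕^p`. -/

lemma fockIntegrand_add {d : ℕ} (φ F G : (Fin d → ℂ) → ℂ) (z w : Fin d → ℂ) :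
    fockIntegrand φ (F + G) z w = fockIntegrand φ F z w + fockIntegrand φ G z w := by
  simp only [fockIntegrand, Pi.add_apply]
  ring

lemma fockIntegrand_smul {d : ℕ} (φ F : (Fin d → ℂ) → ℂ) (c : ℂ) (z w : Fin d → ℂ) :
    fockIntegrand φ (c • F) z w = c * fockIntegrand φ F z w := by
  simp only [fockIntegrand, Pi.smul_apply, smul_eq_mul]
  ring

theorem mainTheorem3 (d : ℕ) (φ : (Fin d → ℂ) → ℂ) (hφ : AEStronglyMeasurable φ volume)
    (S : fockSpace d 1 →ₗ[ℂ] fockSpace d ∞)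
    (hS : ∀ (F : fockSpace d 1) (z : Fin d → ℂ),
      (S F : (Fin d → ℂ) → ℂ) z = ∫ w, fockIntegrand φ F z w)
    (H : (Fin d → ℂ) → ℝ) (hH : Integrable H volume)
    (hbound : ∀ z w : Fin d → ℂ,
      ‖φ (star z - w)‖ ≤
        ‖Complex.exp (Real.pi * ((absSq z + absSq w : ℝ) : ℂ) / 2
          - Real.pi * (w ⬝ᵥ star z))‖ * H (z - w))
    (p : ℝ≥0∞) (hp : 1 ≤ p) :
    ∃ T : fockSpace d p →ₗ[ℂ] fockSpace d p,
      (∀ (F : fockSpace d p) (z : Fin d → ℂ),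
        Integrable (fun w => fockIntegrand φ F z w) volume ∧
        (T F : (Fin d → ℂ) → ℂ) z = ∫ w, fockIntegrand φ F z w) ∧
      (∀ (G : fockSpace d 1) (F : fockSpace d p),
        (G : (Fin d → ℂ) → ℂ) = F → (T F : (Fin d → ℂ) → ℂ) = S G) ∧
      ∃ C : ℝ≥0, ∀ F : fockSpace d p,
        fockNorm p (T F : (Fin d → ℂ) → ℂ) ≤ C * fockNorm p (F : (Fin d → ℂ) → ℂ) := by
  have hb : KernelBound φ H := hbound
  -- The only source of holomorphy: the values of `S` are entire.
  have hone : ∀ F ∈ fockSpace d 1, Differentiable ℂ fun z => ∫ w, fockIntegrand φ F z w := by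
    intro F hF
    have h : (fun z => ∫ w, fockIntegrand φ F z w) = (S ⟨F, hF⟩ : (Fin d → ℂ) → ℂ) :=
      funext fun z => (hS ⟨F, hF⟩ z).symm
    rw [h]
    exact (S ⟨F, hF⟩).2.1
  have hint : ∀ (F : fockSpace d p) (z : Fin d → ℂ),
      Integrable (fun w => fockIntegrand φ F z w) volume := fun F z => by
    obtain ⟨C, hC⟩ := exists_norm_gaussWeighted_le hp F
    exact hb.integrable_fockIntegrand hφ hH F.2.1.continuous hC z
  have hHfin : ∫⁻ u, ‖H u‖ₑ ≠ ∞ := hH.2.ne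
  have hmem : ∀ F : fockSpace d p, (fun z => ∫ w, fockIntegrand φ F z w) ∈ fockSpace d p := by
    intro F
    obtain ⟨C, hC⟩ := exists_norm_gaussWeighted_le hp F
    have hd := hb.differentiable_integral hφ hH hone F.2.1 hC
    exact ⟨hd, (continuous_gaussWeighted hd.continuous).aestronglyMeasurable,
      (hb.fockNorm_integral_le hH F.2.1.continuous hp).trans_lt
        (ENNReal.mul_lt_top hHfin.lt_top F.2.2.2)⟩
  let T : fockSpace d p →ₗ[ℂ] fockSpace d p :=
    { toFun := fun F => ⟨fun z => ∫ w, fockIntegrand φ F z w, hmem F⟩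
      map_add' := fun F G => by
        ext z
        simp only [Submodule.coe_add, Pi.add_apply, fockIntegrand_add]
        exact integral_add (hint F z) (hint G z)
      map_smul' := fun c F => by
        ext z
        simp only [Submodule.coe_smul, Pi.smul_apply, fockIntegrand_smul, RingHom.id_apply,
          smul_eq_mul]
        exact integral_const_mul _ _ }
  refine ⟨T, fun F z => ⟨hint F z, rfl⟩, fun G F hGF => ?_, (∫⁻ u, ‖H u‖ₑ).toNNReal, fun F => ?_⟩
  · funext z
    rw [hS G z, hGF]
    rfl
  · rw [ENNReal.coe_toNNReal hHfin]
    exact hb.fockNorm_integral_le hH F.2.1.continuous hp
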